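/- Let $M$ be a von Neumann algebra on a complex Hilbert space $\mathcal H$. Assume that $M$ is a factor of type $\mathrm{II}_1$, let $\tau$ be a faithful normal trace state on $M$, and let $h\in M$ be a positive invertible element whose spectral measure $E_h(\cdot)$ has the following property: for some $v\in\mathcal H\setminus\{0\}$ the localized measure $\|E_h(\cdot)v\|^2$ on $\mathbb R$ has no atoms. Define $$\varphi\colon M\to\mathbb C,\qquad \varphi(x)=\tau(hx),$$ and let $M^\varphi=\{a\in M\mid \varphi(ab)=\varphi(ba)\text{ for all }b\in M\}$ be the centralizer of $\varphi$. Then $\varphi$ is normal (that is, it belongs to the predual $M_*$) and faithful (that is, $\varphi(a^*a)>0$ whenever $0\neq a\in M$), and there exists no family $\{e_i\}_{i\in I}$ of mutually orthogonal self-adjoint projections in $M$ such that $\sum_{i\in I}e_i=\mathbf 1$ and $$M^\varphi=\Bigl\{\sum_{i\in I}e_ixe_i\;\Big|\;x\in M\Bigr\},$$ where the sums converge in the strong operator topology. -/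

import Mathlib

open scoped InnerProductSpace ComplexOrder CompactlySupported

noncomputable section

namespace VonNeumann

universe u w

variable {H : Type u} [NormedAddCommGroup H] [InnerProductSpace ℂ H] [CompleteSpace H]

/-! ### Spectral measure of a bounded self-adjoint operator -/

/-- The positive functional `f ↦ ⟨f(a) v, v⟩` on compactly supported continuous functions on `ℝ`,
where `f(a)` is the continuous functional calculus of the self-adjoint operator `a`. -/
def spectralFunctional (a : H →L[ℂ] H) (v : H) : C_c(ℝ, ℝ) →ₚ[ℝ] ℝ where
  toFun f := RCLike.re ⟪v, cfc (f : ℝ → ℝ) a v⟫_ℂ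
  map_add' f g := by
    have h : cfc (fun x => f x + g x) a = cfc (f : ℝ → ℝ) a + cfc (g : ℝ → ℝ) a :=
      cfc_add (a := a) f g f.continuous.continuousOn g.continuous.continuousOn
    have h' : ((f + g : C_c(ℝ, ℝ)) : ℝ → ℝ) = fun x => f x + g x := rfl
    rw [h', h, _root_.add_apply, inner_add_right, map_add]
  map_smul' c f := by
    have h : cfc (fun x => c * f x) a = c • cfc (f : ℝ → ℝ) a :=
      cfc_const_mul c (f : ℝ → ℝ) a f.continuous.continuousOn
    have h' : ((c • f : C_c(ℝ, ℝ)) : ℝ → ℝ) = fun x => c * f x := rfl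
    rw [h', h, _root_.smul_apply, inner_smul_right_eq_smul, RCLike.smul_re]
    simp
  monotone' f g hfg := by
    have h : cfc (f : ℝ → ℝ) a ≤ cfc (g : ℝ → ℝ) a :=
      cfc_mono (fun x _ => hfg x) f.continuous.continuousOn g.continuous.continuousOn
    have h2 := (ContinuousLinearMap.le_def _ _).1 h
    have h3 := h2.re_inner_nonneg_right v
    rw [_root_.sub_apply, inner_sub_right, map_sub] at h3
    exact sub_nonneg.1 h3

/-- The scalar spectral measure of the self-adjoint operator `a` at the vector `v`: the Borel
measure on `ℝ` that the Riesz representation theorem attaches to `f ↦ ⟨f(a) v, v⟩`. -/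
def scalarSpectralMeasure (a : H →L[ℂ] H) (v : H) : MeasureTheory.Measure ℝ :=
  RealRMK.rieszMeasure (spectralFunctional a v)

/-- The closed linear span of the vectors `w` whose scalar spectral measure is carried by `S`. -/
def spectralSubspace (a : H →L[ℂ] H) (S : Set ℝ) : Submodule ℂ H :=
  (Submodule.span ℂ {w : H | scalarSpectralMeasure a w Sᶜ = 0}).topologicalClosure

instance (a : H →L[ℂ] H) (S : Set ℝ) : CompleteSpace (spectralSubspace a S) :=
  inferInstanceAs (CompleteSpace
    (Submodule.span ℂ {w : H | scalarSpectralMeasure a w Sᶜ = 0}).topologicalClosure)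

/-- The projection-valued spectral measure `E_a` of the self-adjoint operator `a`: for a Borel set
`S`, `E_a(S)` is the orthogonal projection onto the spectral subspace of `a` for `S`, which consists
of the vectors whose scalar spectral measure vanishes outside `S`. -/
def spectralMeasure (a : H →L[ℂ] H) (S : Set ℝ) : H →L[ℂ] H :=
  (spectralSubspace a S).starProjection

/-! ### Factors of type II₁ -/

/-- A factor: a nonzero von Neumann algebra whose center is the scalars. -/
structure IsFactor (M : VonNeumannAlgebra H) : Prop where
  one_ne_zero : (1 : H →L[ℂ] H) ≠ 0
  center_scalar : ∀ z ∈ M, z ∈ M.commutant → ∃ c : ℂ, z = c • (1 : H →L[ℂ] H)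

/-- A projection `p ∈ M` is finite (relative to `M`) if it is not Murray–von Neumann equivalent
to a proper subprojection. -/
def IsFiniteProjection (M : VonNeumannAlgebra H) (p : H →L[ℂ] H) : Prop :=
  p ∈ M ∧ IsStarProjection p ∧
    ∀ u ∈ M, star u * u = p → u * star u ≤ p → u * star u = p

/-- A projection `p ∈ M` is abelian (relative to `M`) if `pMp` is commutative. -/
def IsAbelianProjection (M : VonNeumannAlgebra H) (p : H →L[ℂ] H) : Prop :=
  p ∈ M ∧ IsStarProjection p ∧
    ∀ x ∈ M, ∀ y ∈ M, (p * x * p) * (p * y * p) = (p * y * p) * (p * x * p)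

/-- A factor of type II₁: the identity is a finite projection and there is no nonzero abelian
projection. -/
structure IsTypeIIOneFactor (M : VonNeumannAlgebra H) : Prop extends IsFactor M where
  finite_one : IsFiniteProjection M 1
  no_abelian : ∀ p : H →L[ℂ] H, IsAbelianProjection M p → p = 0

/-! ### Functionals -/

/-- The functional `φ` belongs to the predual of `M`, that is, it is normal (ultraweakly
continuous): `φ(x) = ∑ ⟨x ξₙ, ηₙ⟩` for some square-summable sequences of vectors. -/
def IsNormalFunctional (M : VonNeumannAlgebra H) (φ : M.toStarSubalgebra →ₗ[ℂ] ℂ) : Prop :=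
  ∃ ξ η : ℕ → H, Summable (fun n => ‖ξ n‖ ^ 2) ∧ Summable (fun n => ‖η n‖ ^ 2) ∧
    ∀ x : M.toStarSubalgebra, HasSum (fun n => ⟪η n, (x : H →L[ℂ] H) (ξ n)⟫_ℂ) (φ x)

/-- `φ(a* a) > 0` whenever `a ≠ 0`. -/
def IsFaithfulFunctional (M : VonNeumannAlgebra H) (φ : M.toStarSubalgebra →ₗ[ℂ] ℂ) : Prop :=
  ∀ a : M.toStarSubalgebra, a ≠ 0 → 0 < φ (star a * a)

/-- A faithful normal tracial state (positivity is part of faithfulness). -/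
structure IsFaithfulNormalTraceState (M : VonNeumannAlgebra H)
    (τ : M.toStarSubalgebra →ₗ[ℂ] ℂ) : Prop where
  map_one : τ 1 = 1
  trace : ∀ x y : M.toStarSubalgebra, τ (x * y) = τ (y * x)
  faithful : IsFaithfulFunctional M τ
  normal : IsNormalFunctional M τ

/-- The functional `x ↦ τ(h x)`. -/
def weightedFunctional (M : VonNeumannAlgebra H) (τ : M.toStarSubalgebra →ₗ[ℂ] ℂ)
    (h : M.toStarSubalgebra) : M.toStarSubalgebra →ₗ[ℂ] ℂ :=
  τ ∘ₗ LinearMap.mulLeft ℂ h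

/-- The centralizer `M^φ = {a ∈ M | φ(ab) = φ(ba) for all b ∈ M}`. -/
def functionalCentralizer (M : VonNeumannAlgebra H) (φ : M.toStarSubalgebra →ₗ[ℂ] ℂ) :
    Set M.toStarSubalgebra :=
  {a | ∀ b : M.toStarSubalgebra, φ (a * b) = φ (b * a)}

/-! ### Partitions of unity by projections -/

/-- `∑ x_i = y` (unconditionally) in the strong operator topology. -/
def HasStrongSum {I : Type w} (x : I → H →L[ℂ] H) (y : H →L[ℂ] H) : Prop :=
  ∀ ξ : H, HasSum (fun i => x i ξ) (y ξ)

/-- A family of mutually orthogonal self-adjoint projections in `M` with sum `1`. -/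
structure IsProjectionPartition (M : VonNeumannAlgebra H) {I : Type w}
    (e : I → M.toStarSubalgebra) : Prop where
  isStarProjection : ∀ i, IsStarProjection (e i)
  orthogonal : ∀ i j, i ≠ j → e i * e j = 0
  sum_one : HasStrongSum (fun i => (e i : H →L[ℂ] H)) 1

/-- The set `{∑ e_i x e_i | x ∈ M}`. -/
def blockDiagonal (M : VonNeumannAlgebra H) {I : Type w} (e : I → M.toStarSubalgebra) :
    Set M.toStarSubalgebra :=
  {y | ∃ x : M.toStarSubalgebra,
    HasStrongSum (fun i => ((e i * x * e i : M.toStarSubalgebra) : H →L[ℂ] H)) (y : H →L[ℂ] H)}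

end VonNeumann

end

namespace VonNeumann

/-! ### Eigenvectors and atoms of the spectral measure. -/

section Atoms

variable {H : Type*} [NormedAddCommGroup H] [InnerProductSpace ℂ H] [CompleteSpace H]

/-! If the centralizer were block diagonal for `e`, it would contain every corner `e i * M * e i`.
By traciality and faithfulness of `τ` these corners commute with `h`. A factor is prime, so an
element commuting with a corner is scalar on it (`IsFactor.exists_real_mul_eq_smul`), and each `e i
v` is zero or an eigenvector of `h`. As `E_h({c}) v = 0` for all `c`, `v` is orthogonal to all
eigenvectors (`inner_eq_zero_of_eigenvector`). Hence `e i v = 0` for all `i`, and summing gives `v =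
0`. -/

theorem cfc_apply_eq_zero_of_eigenvector {a : H →L[ℂ] H} (ha : IsSelfAdjoint a) {w : H} {c : ℝ}
    (hw : a w = (c : ℂ) • w) {f : ℝ → ℝ} (hf : Continuous f) {ε : ℝ} (hε : 0 < ε)
    (hfε : ∀ x ∈ Metric.closedBall c ε, f x = 0) : cfc f a w = 0 := by
  -- Factor `f` as `g * (x - c)` with `g` continuous: the truncated denominator differs from `(x -
  -- c) ^ 2` only where `f` vanishes. Then `f(a) w = g(a) (a - c) w = 0`.
  have hpos : ∀ x : ℝ, 0 < max (ε ^ 2) ((x - c) ^ 2) := fun x => lt_max_of_lt_left (by positivity)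
  have hg : Continuous fun x => f x * (x - c) / max (ε ^ 2) ((x - c) ^ 2) :=
    Continuous.div (by fun_prop) (by fun_prop) fun x => (hpos x).ne'
  have hfg : f = fun x => (f x * (x - c) / max (ε ^ 2) ((x - c) ^ 2)) * (x - c) := by
    funext x
    by_cases hx : x ∈ Metric.closedBall c ε
    · simp [hfε x hx]
    · have h1 : ε < |x - c| := by simpa [Real.dist_eq] using hx
      have h2 : ε ^ 2 ≤ (x - c) ^ 2 := by
        rw [← sq_abs (x - c)]
        gcongr
      have h3 : x - c ≠ 0 := by
        intro h0
        rw [h0, abs_zero] at h1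
        exact hε.not_gt h1
      simp only [max_eq_right h2]
      field_simp
  have hlin : cfc (fun x : ℝ => x - c) a = a - algebraMap ℝ (H →L[ℂ] H) c := by
    rw [cfc_sub (fun x : ℝ => x) (fun _ => c) a (by fun_prop) (by fun_prop), cfc_id' ℝ a,
      cfc_const c a]
  rw [hfg, cfc_mul _ (fun x : ℝ => x - c) a hg.continuousOn (by fun_prop), hlin,
    mul_apply_eq_comp, _root_.sub_apply, hw, Algebra.algebraMap_eq_smul_one,
    _root_.smul_apply, one_apply_eq_self]
  simp

/-- By inner regularity it is enough to test compact sets missing `c`; a Urysohn function vanishing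
near `c` bounds their measure by `⟪w, f(a) w⟫ = 0`. -/
theorem mem_spectralSubspace_of_eigenvector {a : H →L[ℂ] H} (ha : IsSelfAdjoint a) {w : H} {c : ℝ}
    (hw : a w = (c : ℂ) • w) : w ∈ spectralSubspace a {c} := by
  refine Submodule.le_topologicalClosure _ (Submodule.subset_span ?_)
  change RealRMK.rieszMeasure (spectralFunctional a w) {c}ᶜ = 0
  rw [isOpen_compl_singleton.measure_eq_iSup_isCompact]
  simp only [ENNReal.iSup_eq_zero]
  intro K hKc hK
  obtain ⟨ε, hε, hεK⟩ := Metric.nhds_basis_closedBall.mem_iff.1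
    (hK.isClosed.isOpen_compl.mem_nhds (fun h => hKc h rfl : c ∈ Kᶜ))
  obtain ⟨f, hf1, hf0, hfc, hfI⟩ := exists_continuous_one_zero_of_isCompact hK
    (Metric.isClosed_closedBall (x := c) (ε := ε)) (Set.subset_compl_iff_disjoint_left.1 hεK)
  have hle := RealRMK.rieszMeasure_le_of_eq_one (spectralFunctional a w) (f := ⟨f, hfc⟩)
    (fun x => (hfI x).1) hK hf1
  have h0 : spectralFunctional a w ⟨f, hfc⟩ = 0 := by
    change RCLike.re ⟪w, cfc (f : ℝ → ℝ) a w⟫_ℂ = 0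
    rw [cfc_apply_eq_zero_of_eigenvector ha hw f.continuous hε hf0]
    simp
  rw [h0, ENNReal.ofReal_zero] at hle
  exact le_antisymm hle bot_le

theorem inner_eq_zero_of_eigenvector {a : H →L[ℂ] H} (ha : IsSelfAdjoint a) {v w : H} {c : ℝ}
    (hw : a w = (c : ℂ) • w) (hv : spectralMeasure a {c} v = 0) : ⟪v, w⟫_ℂ = 0 := by
  have h := Submodule.starProjection_inner_eq_zero (K := spectralSubspace a {c}) v w
    (mem_spectralSubspace_of_eigenvector ha hw)
  have hv' : (spectralSubspace a {c}).starProjection v = 0 := hv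
  rwa [hv', sub_zero] at h

end Atoms

/-! ### Primeness of factors and elements commuting with a corner. -/

section Factor

variable {H : Type*} [NormedAddCommGroup H] [InnerProductSpace ℂ H] [CompleteSpace H]
  {M : VonNeumannAlgebra H}

theorem mem_of_forall_commute {a : H →L[ℂ] H} (ha : ∀ y ∈ M.commutant, Commute y a) : a ∈ M := by
  rw [← M.commutant_commutant, VonNeumannAlgebra.mem_commutant_iff]
  exact ha

theorem commute_of_mem_commutant {a y : H →L[ℂ] H} (ha : a ∈ M) (hy : y ∈ M.commutant) :
    Commute a y :=
  VonNeumannAlgebra.mem_commutant_iff.1 hy a ha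

theorem starProjection_mem {K : Submodule ℂ H} [K.HasOrthogonalProjection]
    (hK : ∀ y ∈ M.commutant, ∀ w ∈ K, y w ∈ K) : K.starProjection ∈ M := by
  rw [VonNeumannAlgebra.IsStarProjection.mem_iff isStarProjection_starProjection]
  intro y hy
  rw [Submodule.range_starProjection]
  exact fun w hw => hK y hy w hw

/-- A factor is a prime ring. -/
theorem IsFactor.eq_zero_or_eq_zero (hM : IsFactor M) {a b : H →L[ℂ] H} (hb : b ∈ M)
    (hab : ∀ x ∈ M, a * x * b = 0) : a = 0 ∨ b = 0 := by
  -- The closed span `K` of `M b H` is invariant under `M` and `M'`, so its projection is a central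
  -- scalar `c`. It fixes the range of `b`, and `a` kills `K`: `c = 0` forces `b = 0`, and `c ≠ 0`
  -- forces `a = 0`.
  set S : Set H := {w | ∃ x ∈ M, ∃ ξ, w = x (b ξ)} with hS
  set K : Submodule ℂ H := (Submodule.span ℂ S).topologicalClosure with hK
  have invariant_of : ∀ y : H →L[ℂ] H, (∀ w ∈ S, y w ∈ S) → ∀ w ∈ K, y w ∈ K := by
    intro y hy
    have h1 : Submodule.span ℂ S ≤ K.comap (y : H →ₗ[ℂ] H) :=
      Submodule.span_le.2 fun w hw =>
        Submodule.le_topologicalClosure _ (Submodule.subset_span (hy w hw))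
    have hcl : IsClosed ((K.comap (y : H →ₗ[ℂ] H) : Submodule ℂ H) : Set H) :=
      (Submodule.isClosed_topologicalClosure _).preimage y.continuous
    exact fun w hw => Submodule.topologicalClosure_minimal _ h1 hcl hw
  have hKc : IsClosed (K : Set H) := Submodule.isClosed_topologicalClosure _
  have : CompleteSpace K := hKc.completeSpace_coe
  have hqM : K.starProjection ∈ M := by
    refine starProjection_mem fun y hy => invariant_of y ?_
    rintro _ ⟨x, hx, ξ, rfl⟩
    refine ⟨x, hx, y ξ, ?_⟩
    have h1 := DFunLike.congr_fun (commute_of_mem_commutant (mul_mem hx hb) hy).eq ξ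
    exact h1.symm
  have hqM' : K.starProjection ∈ M.commutant := by
    refine starProjection_mem fun y hy => invariant_of y ?_
    rw [VonNeumannAlgebra.commutant_commutant] at hy
    rintro _ ⟨x, hx, ξ, rfl⟩
    exact ⟨y * x, mul_mem hy hx, ξ, rfl⟩
  obtain ⟨c, hc⟩ := hM.center_scalar _ hqM hqM'
  have hqb : ∀ ξ, c • b ξ = b ξ := by
    intro ξ
    have hmem : b ξ ∈ K := Submodule.le_topologicalClosure _
      (Submodule.subset_span ⟨1, one_mem M, ξ, rfl⟩)
    have := Submodule.starProjection_eq_self_iff.2 hmem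
    rwa [hc] at this
  have haK : ∀ w ∈ K, a w = 0 := by
    have h1 : Submodule.span ℂ S ≤ LinearMap.ker (a : H →ₗ[ℂ] H) := by
      refine Submodule.span_le.2 ?_
      rintro _ ⟨x, hx, ξ, rfl⟩
      exact DFunLike.congr_fun (hab x hx) ξ
    have hcl : IsClosed ((LinearMap.ker (a : H →ₗ[ℂ] H) : Submodule ℂ H) : Set H) :=
      isClosed_singleton.preimage a.continuous
    exact fun w hw => Submodule.topologicalClosure_minimal _ h1 hcl hw
  by_cases hc0 : c = 0
  · right
    ext ξ
    rw [← hqb ξ, hc0, zero_smul]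
    rfl
  · left
    ext ξ
    have h1 : a (c • ξ) = 0 := by
      refine haK _ ?_
      have := Submodule.starProjection_apply_mem K ξ
      rwa [hc] at this
    rw [map_smul] at h1
    exact (smul_eq_zero.1 h1).resolve_left hc0

theorem cfc_mem {a : H →L[ℂ] H} (ha : a ∈ M) (f : ℝ → ℝ) : cfc f a ∈ M :=
  mem_of_forall_commute fun _ hy => ((commute_of_mem_commutant ha hy).cfc_real f).symm

/-- In a factor, if a self-adjoint `h` commutes with the corner `eMe`, then its quadratic form
cannot take values on both sides of `t` on the range of `e`. -/
theorem IsFactor.not_re_inner_lt_lt (hM : IsFactor M) {h e : H →L[ℂ] H} (hh : h ∈ M)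
    (hsa : IsSelfAdjoint h) (he : e ∈ M)
    (hhe : Commute h e) (hcomm : ∀ x ∈ M, Commute h (e * x * e)) {v w : H} (hv : e v = v) (hw : e w = w) {t : ℝ}
    (htv : RCLike.re ⟪v, h v⟫_ℂ < t * ‖v‖ ^ 2) (htw : t * ‖w‖ ^ 2 < RCLike.re ⟪w, h w⟫_ℂ) :
    False := by
  -- `p` and `n` are the positive and negative parts of `h - t`. Since `p` commutes with `e * x * e`
  -- and `p * n = 0`, primeness applies to `p * e` and `e * n`.
  set p := cfc (fun x : ℝ => max (x - t) 0) h with hp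
  set n := cfc (fun x : ℝ => max (t - x) 0) h with hn
  have hp0 : 0 ≤ p := cfc_nonneg fun x _ => le_max_right _ _
  have hn0 : 0 ≤ n := cfc_nonneg fun x _ => le_max_right _ _
  have hpn : p * n = 0 := by
    rw [hp, hn, ← cfc_mul _ _ h (by fun_prop) (by fun_prop), ← cfc_zero ℝ h]
    congr 1
    funext x
    rcases le_total x t with hx | hx
    · simp [max_eq_right (sub_nonpos.2 hx)]
    · simp [max_eq_right (sub_nonpos.2 hx)]
  have hsub : p - n = h - algebraMap ℝ (H →L[ℂ] H) t := by
    rw [hp, hn, ← cfc_sub _ _ h (by fun_prop) (by fun_prop)]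
    have : (fun x : ℝ => max (x - t) 0 - max (t - x) 0) = fun x => x - t := by
      funext x
      rcases le_total x t with hx | hx
      · rw [max_eq_right (sub_nonpos.2 hx), max_eq_left (sub_nonneg.2 hx)]; ring
      · rw [max_eq_left (sub_nonneg.2 hx), max_eq_right (sub_nonpos.2 hx)]; ring
    rw [this, cfc_sub (fun x : ℝ => x) (fun _ => t) h (by fun_prop) (by fun_prop), cfc_id' ℝ h,
      cfc_const t h]
  have hre : ∀ u : H, RCLike.re ⟪u, p u⟫_ℂ - RCLike.re ⟪u, n u⟫_ℂ
      = RCLike.re ⟪u, h u⟫_ℂ - t * ‖u‖ ^ 2 := by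
    intro u
    have h1 := congrArg (fun z => RCLike.re ⟪u, z⟫_ℂ) (DFunLike.congr_fun hsub u)
    have h2 : (algebraMap ℝ (H →L[ℂ] H) t) u = (t : ℂ) • u := by
      rw [Algebra.algebraMap_eq_smul_one]
      simp
    simp only [_root_.sub_apply, inner_sub_right, map_sub, h2, inner_smul_right,
      inner_self_eq_norm_sq_to_K] at h1
    rw [h1, ← RCLike.ofReal_pow]
    change _ - RCLike.re ((t : ℂ) * ((‖u‖ ^ 2 : ℝ) : ℂ)) = _
    rw [← Complex.ofReal_mul]
    rfl
  have hpos : ∀ {q : H →L[ℂ] H}, 0 ≤ q → ∀ u, 0 ≤ RCLike.re ⟪u, q u⟫_ℂ := fun hq u =>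
    ((ContinuousLinearMap.nonneg_iff_isPositive _).1 hq).re_inner_nonneg_right u
  have hnM : n ∈ M := cfc_mem hh _
  have hzero : ∀ x ∈ M, p * e * x * (e * n) = 0 := by
    intro x hx
    have h1 : Commute p (e * x * e) := (hcomm x hx).cfc_real _
    calc p * e * x * (e * n) = p * (e * x * e) * n := by noncomm_ring
      _ = (e * x * e) * (p * n) := by rw [h1.eq]; noncomm_ring
      _ = 0 := by rw [hpn, mul_zero]
  have hne : Commute n e := hhe.cfc_real _
  -- If `p * e = 0`, the form of `h - t` is nonpositive on the range of `e`, against `w`; if `e * n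
  -- = 0`, it is nonnegative there, against `v`.
  rcases hM.eq_zero_or_eq_zero (mul_mem he hnM) hzero with h0 | h0
  · have h1 : p w = 0 := by
      have := DFunLike.congr_fun h0 w
      rwa [mul_apply_eq_comp, hw] at this
    have h2 := hre w
    rw [h1, inner_zero_right, map_zero] at h2
    linarith [hpos hn0 w]
  · have h1 : n v = 0 := by
      rw [← hne.eq] at h0
      have := DFunLike.congr_fun h0 v
      rwa [mul_apply_eq_comp, hv] at this
    have h2 := hre v
    rw [h1, inner_zero_right, map_zero] at h2
    linarith [hpos hp0 v]

/-- In a factor, a self-adjoint element that commutes with the corner `eMe` is a scalar on the range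
of `e`. -/
theorem IsFactor.exists_real_mul_eq_smul (hM : IsFactor M) {h e : H →L[ℂ] H} (hh : h ∈ M)
    (hsa : IsSelfAdjoint h) (he : e ∈ M) (hproj : IsStarProjection e)
    (hcomm : ∀ x ∈ M, Commute h (e * x * e)) : ∃ c : ℝ, h * e = (c : ℂ) • e := by
  have hee : ∀ ξ, e (e ξ) = e ξ := fun ξ => DFunLike.congr_fun hproj.isIdempotentElem.eq ξ
  have hhe : Commute h e := by
    have := hcomm 1 (one_mem M)
    rwa [mul_one, hproj.isIdempotentElem.eq] at this
  by_cases h0 : e = 0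
  · exact ⟨0, by simp [h0]⟩
  obtain ⟨ξ, hξ⟩ : ∃ ξ, e ξ ≠ 0 := by
    by_contra hcon
    push Not at hcon
    exact h0 (ContinuousLinearMap.ext hcon)
  have hn0 : 0 < ‖e ξ‖ ^ 2 := by positivity
  -- All Rayleigh quotients of `h` on the range of `e` equal this one: a number `t` strictly between
  -- two of them would contradict the previous lemma.
  set c : ℝ := RCLike.re ⟪e ξ, h (e ξ)⟫_ℂ / ‖e ξ‖ ^ 2 with hc
  refine ⟨c, ?_⟩
  have hquad : ∀ w, e w = w → RCLike.re ⟪w, h w⟫_ℂ = c * ‖w‖ ^ 2 := by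
    intro w hw
    by_cases hw0 : w = 0
    · simp [hw0]
    have hnw : 0 < ‖w‖ ^ 2 := by positivity
    rw [← div_eq_iff hnw.ne']
    rcases lt_trichotomy (RCLike.re ⟪w, h w⟫_ℂ / ‖w‖ ^ 2) c with hlt | heq | hlt
    · obtain ⟨t, h1, h2⟩ := exists_between hlt
      exact (hM.not_re_inner_lt_lt hh hsa he hhe hcomm hw (hee ξ) ((div_lt_iff₀ hnw).1 h1)
        ((lt_div_iff₀ hn0).1 h2)).elim
    · exact heq
    · obtain ⟨t, h1, h2⟩ := exists_between hlt
      exact (hM.not_re_inner_lt_lt hh hsa he hhe hcomm (hee ξ) hw ((div_lt_iff₀ hn0).1 h1)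
        ((lt_div_iff₀ hnw).1 h2)).elim
  have hsym : ∀ x y : H, ⟪e x, y⟫_ℂ = ⟪x, e y⟫_ℂ :=
    hproj.isSelfAdjoint.isSymmetric
  have hhsym : ∀ x y : H, ⟪h x, y⟫_ℂ = ⟪x, h y⟫_ℂ := hsa.isSymmetric
  -- Over `ℂ`, the quadratic form determines the operator.
  have hlin : ((h * e : H →L[ℂ] H) : H →ₗ[ℂ] H) = (((c : ℂ) • e : H →L[ℂ] H) : H →ₗ[ℂ] H) := by
    refine (ext_inner_map _ _).1 fun x => ?_
    have h1 : ⟪(h * e) x, x⟫_ℂ = ⟪h (e x), e x⟫_ℂ := by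
      rw [← hsym, ← mul_apply_eq_comp e h, ← hhe.eq, mul_apply_eq_comp,
        mul_apply_eq_comp, hee]
    have h2 : ⟪e x, x⟫_ℂ = ⟪e x, e x⟫_ℂ := by rw [← hsym, hee]
    have h3 : ((RCLike.re ⟪h (e x), e x⟫_ℂ : ℝ) : ℂ) = ⟪h (e x), e x⟫_ℂ := by
      refine RCLike.conj_eq_iff_re.1 ?_
      rw [inner_conj_symm, hhsym]
    have h4 := hquad (e x) (hee x)
    rw [← hhsym] at h4
    change ⟪(h * e) x, x⟫_ℂ = ⟪(c : ℂ) • e x, x⟫_ℂ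
    rw [h1, inner_smul_left, h2, ← h3, h4, inner_self_eq_norm_sq_to_K]
    simp
  exact ContinuousLinearMap.coe_injective hlin

end Factor

/-! ### The weighted trace and its centralizer. -/

section Functionals

variable {H : Type*} [NormedAddCommGroup H] [InnerProductSpace ℂ H] [CompleteSpace H]
  {M : VonNeumannAlgebra H} {τ : M.toStarSubalgebra →ₗ[ℂ] ℂ} {h : M.toStarSubalgebra}

theorem IsNormalFunctional.weightedFunctional (hτ : IsNormalFunctional M τ)
    (h : M.toStarSubalgebra) : IsNormalFunctional M (weightedFunctional M τ h) := by
  obtain ⟨ξ, η, hξ, hη, hsum⟩ := hτ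
  refine ⟨ξ, fun n => ContinuousLinearMap.adjoint (h : H →L[ℂ] H) (η n), hξ, ?_, fun x => ?_⟩
  · refine Summable.of_nonneg_of_le (fun n => by positivity) (fun n => ?_)
      (hη.mul_left (‖ContinuousLinearMap.adjoint (h : H →L[ℂ] H)‖ ^ 2))
    rw [← mul_pow]
    gcongr
    exact ContinuousLinearMap.le_opNorm _ _
  · simp only [ContinuousLinearMap.adjoint_inner_left]
    exact hsum (h * x)

/-- Traciality turns the centralizer condition into `τ ([h, a] * b) = 0` for all `b`; taking `b =
star [h, a]` and using faithfulness gives `[h, a] = 0`. -/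
theorem IsFaithfulNormalTraceState.commute_of_mem_centralizer
    (hτ : IsFaithfulNormalTraceState M τ) {a : M.toStarSubalgebra}
    (ha : a ∈ functionalCentralizer M (weightedFunctional M τ h)) : h * a = a * h := by
  have h1 : ∀ b, τ ((h * a - a * h) * b) = 0 := by
    intro b
    have h2 : τ (h * (a * b)) = τ (h * (b * a)) := ha b
    have h3 : τ (h * (b * a)) = τ (a * h * b) := by
      rw [← mul_assoc, hτ.trace, mul_assoc a h b]
    rw [sub_mul, map_sub, mul_assoc h a b, h2, h3, sub_self]
  by_contra hne
  have h4 : star (h * a - a * h) ≠ 0 := fun h0 => hne (sub_eq_zero.1 (star_eq_zero.1 h0))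
  have h5 := hτ.faithful _ h4
  rw [star_star, h1] at h5
  exact lt_irrefl _ h5

/-- With `k = √h`, traciality gives `φ (star a * a) = τ (star (a * k) * (a * k))`, and `a * k = 0`
would force `a * h = 0`. -/
theorem IsFaithfulNormalTraceState.isFaithfulFunctional_weightedFunctional
    (hτ : IsFaithfulNormalTraceState M τ) (h_pos : (h : H →L[ℂ] H).IsPositive)
    (h_unit : IsUnit h) : IsFaithfulFunctional M (weightedFunctional M τ h) := by
  intro a ha
  have h0 : 0 ≤ (h : H →L[ℂ] H) := (ContinuousLinearMap.nonneg_iff_isPositive _).2 h_pos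
  have hkM : cfc Real.sqrt (h : H →L[ℂ] H) ∈ M := cfc_mem h.2 _
  set k : M.toStarSubalgebra := ⟨cfc Real.sqrt (h : H →L[ℂ] H), hkM⟩ with hk
  have hkk : k * k = h := by
    apply Subtype.ext
    change cfc Real.sqrt (h : H →L[ℂ] H) * cfc Real.sqrt (h : H →L[ℂ] H) = h
    rw [← cfc_mul _ _ _ (by fun_prop) (by fun_prop)]
    conv_rhs => rw [← cfc_id' ℝ (h : H →L[ℂ] H) h_pos.isSelfAdjoint]
    refine cfc_congr fun x hx => Real.mul_self_sqrt (spectrum_nonneg_of_nonneg h0 hx)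
  have hks : star k = k := by
    apply Subtype.ext
    exact (cfc_predicate Real.sqrt (h : H →L[ℂ] H) : IsSelfAdjoint _).star_eq
  have hak : a * k ≠ 0 := by
    intro h1
    apply ha
    have h2 : a * h = 0 := by rw [← hkk, ← mul_assoc, h1, zero_mul]
    exact (h_unit.mul_left_eq_zero).1 h2
  have h3 := hτ.faithful _ hak
  have h4 : weightedFunctional M τ h (star a * a) = τ (star (a * k) * (a * k)) := by
    change τ (h * (star a * a)) = _
    rw [star_mul, hks, ← hkk, mul_assoc k k, hτ.trace]
    simp only [mul_assoc]
  rwa [h4]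

theorem IsProjectionPartition.mul_mul_mem_blockDiagonal {I : Type*} {e : I → M.toStarSubalgebra}
    (he : IsProjectionPartition M e) (i : I) (x : M.toStarSubalgebra) :
    e i * x * e i ∈ blockDiagonal M e := by
  refine ⟨e i * x * e i, fun ξ => ?_⟩
  have hid : e i * e i = e i := (he.isStarProjection i).isIdempotentElem.eq
  have h1 : e i * (e i * x * e i) * e i = e i * x * e i := by
    calc e i * (e i * x * e i) * e i = (e i * e i) * x * (e i * e i) := by simp only [mul_assoc]
      _ = _ := by rw [hid]
  have h2 := hasSum_single (f := fun j =>
    ((e j * (e i * x * e i) * e j : M.toStarSubalgebra) : H →L[ℂ] H) ξ) i (fun j hj => by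
      have h3 : e j * (e i * x * e i) * e j = 0 := by
        rw [← mul_assoc, ← mul_assoc, he.orthogonal j i hj]
        simp
      simp only [h3]
      rfl)
  simpa only [h1] using h2

end Functionals

end VonNeumann

theorem proposition2p12 {H : Type*} [NormedAddCommGroup H] [InnerProductSpace ℂ H]
    [CompleteSpace H] (M : VonNeumannAlgebra H) (hM : VonNeumann.IsTypeIIOneFactor M)
    (τ : M.toStarSubalgebra →ₗ[ℂ] ℂ) (hτ : VonNeumann.IsFaithfulNormalTraceState M τ)
    (h : M.toStarSubalgebra) (h_pos : (h : H →L[ℂ] H).IsPositive) (h_unit : IsUnit h)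
    (h_atomless : ∃ v : H, v ≠ 0 ∧
      ∀ t : ℝ, ‖VonNeumann.spectralMeasure (h : H →L[ℂ] H) {t} v‖ ^ 2 = 0) :
    VonNeumann.IsNormalFunctional M (VonNeumann.weightedFunctional M τ h) ∧
    VonNeumann.IsFaithfulFunctional M (VonNeumann.weightedFunctional M τ h) ∧
    ¬ ∃ (I : Type*) (e : I → M.toStarSubalgebra), VonNeumann.IsProjectionPartition M e ∧
      VonNeumann.functionalCentralizer M (VonNeumann.weightedFunctional M τ h) =
        VonNeumann.blockDiagonal M e := by
  refine ⟨hτ.normal.weightedFunctional h,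
    hτ.isFaithfulFunctional_weightedFunctional h_pos h_unit, ?_⟩
  rintro ⟨I, e, he, heq⟩
  obtain ⟨v, hv0, hv⟩ := h_atomless
  have hv' : ∀ t : ℝ, VonNeumann.spectralMeasure (h : H →L[ℂ] H) {t} v = 0 := fun t =>
    norm_eq_zero.1 (pow_eq_zero_iff two_ne_zero |>.1 (hv t))
  have hsa := h_pos.isSelfAdjoint
  have hev : ∀ i, (e i : H →L[ℂ] H) v = 0 := by
    intro i
    have hproj : IsStarProjection (e i : H →L[ℂ] H) :=
      ⟨congrArg Subtype.val (he.isStarProjection i).isIdempotentElem.eq,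
        congrArg Subtype.val (he.isStarProjection i).isSelfAdjoint.star_eq⟩
    obtain ⟨c, hc⟩ := hM.toIsFactor.exists_real_mul_eq_smul h.2 hsa (e i).2 hproj fun x hx => by
      have hmem := he.mul_mul_mem_blockDiagonal i ⟨x, hx⟩
      rw [← heq] at hmem
      exact congrArg Subtype.val (hτ.commute_of_mem_centralizer hmem)
    -- The eigenvector equation holds for `e i v`, so `v ⊥ e i v`, which means `‖e i v‖ ^ 2 = 0`.
    have h1 := VonNeumann.inner_eq_zero_of_eigenvector hsa (v := v)
      (DFunLike.congr_fun hc v) (hv' c)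
    have h2 : ⟪(e i : H →L[ℂ] H) v, (e i : H →L[ℂ] H) v⟫_ℂ = 0 := by
      rw [hproj.isSelfAdjoint.isSymmetric.apply_clm, ← mul_apply_eq_comp,
        hproj.isIdempotentElem.eq]
      exact h1
    exact inner_self_eq_zero.1 h2
  refine hv0 ?_
  have hsum := he.sum_one v
  simp only [hev] at hsum
  exact hsum.unique hasSum_zero
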